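/- **Notation.** Let $G$ be a finite multigraph (loops and multiple edges allowed) with vertex set $V$, $|V|=n$, and edge set $E(G)=\{e_1,\dots,e_m\}$; write $\mathfrak S_V\cong\mathfrak S_n$ for the symmetric group on $V$. All modules are over $\mathbb C$, and $\mathcal S^\lambda$ is the Specht module of $\lambda$. For a finite set $B$ with $|B|=b\ge 1$ let $\mathcal L_B=\bigwedge^*\mathcal S^{(b-1,1)}=\bigoplus_{k=0}^{b-1}\mathcal S^{(b-k,1^k)}$, a graded $\mathfrak S_B$-module, where $\mathcal S^{(b-1,1)}$ is the module of functions $B\to\mathbb C$ with sum zero (so it is $0$ if $b=1$). For $F\subseteq E(G)$ let $B_1,\dots,B_r$ be the vertex sets of the connected components of the spanning subgraph $(V,F)$, and let $$\mathcal M_F=\mathrm{Ind}_{\mathfrak S_{B_1}\times\cdots\times\mathfrak S_{B_r}}^{\mathfrak S_V}\bigl(\mathcal L_{B_1}\otimes\cdots\otimes\mathcal L_{B_r}\bigr),$$ graded by total exterior degree $j$. For $i,j\ge 0$ put $C_{i,j}(G)=\bigoplus_{|F|=i}(\mathcal M_F)_j$. For $e\in F$ and $F'=F-e$ let $d_{F,F'}:\mathcal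 M_F\to\mathcal M_{F'}$ be the following degree-preserving $\mathfrak S_V$-map. If $F$ and $F'$ have the same components, it is the identity. If a component $B$ of $F$ splits into components $A,A'$ of $F'$, put $\mathcal T=\mathcal S^{(|A|-1,1)}\oplus\mathcal S^{(|A'|-1,1)}$, so that $\mathrm{Res}^{\mathfrak S_B}_{\mathfrak S_A\times\mathfrak S_{A'}}\mathcal S^{(|B|-1,1)}=\mathcal T\oplus\mathbf 1$ and $\mathrm{Res}\,\mathcal L_B=\bigwedge^*\mathcal T\oplus(\bigwedge^*\mathcal T)[1]$; the map $\mathcal L_B\to\mathrm{Ind}_{\mathfrak S_A\times\mathfrak S_{A'}}^{\mathfrak S_B}(\mathcal L_A\otimes\mathcal L_{A'})$ corresponds by Frobenius reciprocity to the $\mathfrak S_A\times\mathfrak S_{A'}$-map $\mathrm{Res}\,\mathcal L_B\to\bigwedge^*\mathcal T=\mathcal L_A\otimes\mathcal L_{A'}$ that is the identity on $\bigwedge^*\mathcal T$ and zero on $(\bigwedge^*\mathcal T)[1]$, and $d_{F,F'}$ is obtained from it by tensoring with the identity on the remaining components and inducing to $\mathfrak S_V$. The differential $d_{i,j}:C_{i,j}(G)\to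 C_{i-1,j}(G)$ is the sum of all $(-1)^{k}d_{F,F'}$ with $|F|=i$ and $F'=F-e_p$ for some $e_p\in F$, where $k$ is the number of indices $l>p$ with $e_l\notin F$. The chromatic symmetric homology of $G$ is $H_*(G)=\bigoplus_{i,j\ge0}H_{i,j}(G)$ with $H_{i,j}(G)=\ker d_{i,j}/\operatorname{im}d_{i+1,j}$, a bigraded $\mathfrak S_V$-module. **Proposition 3.2.** Let $G$ be a finite multigraph, and let $e\neq e'$ be two edges of $G$ that both join the vertices $x$ and $y$ (where $x=y$ is allowed). Let $G-e'$ be the multigraph obtained by deleting the edge $e'$. Then $H_*(G)\cong H_*(G-e')$ as bigraded $\mathfrak S_V$-modules: for all $i,j\ge 0$ there is an isomorphism of $\mathfrak S_V$-modules $$H_{i,j}(G)\cong H_{i,j}(G-e'),$$ whatever enumerations of the edges of $G$ and of $G-e'$ are used to define the two sides. -/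

import Mathlib

open CategoryTheory CategoryTheory.Limits
open scoped Graph

noncomputable section

namespace ChromaticSymmetric

/-! ### The graded module of a partition of the vertex set

Throughout this part `V` is a finite set and a setoid `r` on `V` records a partition of `V` into
blocks `B₁, …, B_k`. -/

section Partition

variable {V : Type*}

/-- The Young subgroup `𝔖_{B₁} × ⋯ × 𝔖_{B_k}` of `𝔖_V`: the permutations that map every block
of `r` to itself. -/
def youngSubgroup (r : Setoid V) : Subgroup (Equiv.Perm V) where
  carrier := {g | ∀ x, r (g x) x}
  mul_mem' {a b} ha hb x := r.trans (ha (b x)) (hb x)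
  one_mem' x := r.refl x
  inv_mem' {a} ha x := by
    have h := ha (a⁻¹ x)
    rw [← Equiv.Perm.mul_apply, mul_inv_cancel, Equiv.Perm.one_apply] at h
    exact r.symm h

theorem youngSubgroup_mono {r s : Setoid V} (h : s ≤ r) : youngSubgroup s ≤ youngSubgroup r :=
  fun _ hg x => h (hg x)

variable [Fintype V]

open Classical in
/-- The block of `r` that contains `x`. -/
def block (r : Setoid V) (x : V) : Finset V := Finset.univ.filter fun y => r x y

theorem mem_block {r : Setoid V} {x y : V} : y ∈ block r x ↔ r x y := by
  simp [block]

theorem block_eq {r : Setoid V} {x y : V} (h : r x y) : block r x = block r y := by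
  ext z
  rw [mem_block, mem_block]
  exact ⟨fun hz => r.trans (r.symm h) hz, fun hz => r.trans h hz⟩

theorem card_block_ne_zero (r : Setoid V) (x : V) : ((block r x).card : ℂ) ≠ 0 :=
  Nat.cast_ne_zero.mpr (Finset.card_ne_zero_of_mem (mem_block.mpr (r.refl x)))

/-- The functions `V → ℂ` whose sum over every block is zero. The functions on a block `B` with
sum zero are the standard representation `𝒮^(|B|-1,1)` of `𝔖_B` (which is zero if `|B| = 1`), so
this is the direct sum `𝒮^(|B₁|-1,1) ⊕ ⋯ ⊕ 𝒮^(|B_k|-1,1)` of these over all blocks. -/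
def zeroSum (r : Setoid V) : Submodule ℂ (V → ℂ) where
  carrier := {v | ∀ x, ∑ y ∈ block r x, v y = 0}
  add_mem' {a b} ha hb x := by
    simp only [Pi.add_apply, Finset.sum_add_distrib, ha x, hb x, add_zero]
  zero_mem' x := by simp
  smul_mem' c a ha x := by
    simp only [Pi.smul_apply, ← Finset.smul_sum, ha x, smul_zero]

theorem sum_block_comp_inv {r : Setoid V} {g : Equiv.Perm V} (hg : g ∈ youngSubgroup r)
    (v : V → ℂ) (x : V) : ∑ y ∈ block r x, v (g⁻¹ y) = ∑ y ∈ block r x, v y := by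
  refine Finset.sum_equiv g⁻¹ (fun y => ?_) (fun _ _ => rfl)
  have hy : r (g⁻¹ y) y := (youngSubgroup r).inv_mem hg y
  rw [mem_block, mem_block]
  exact ⟨fun h => r.trans h (r.symm hy), fun h => r.trans h hy⟩

/-- The action of the Young subgroup on `zeroSum r` by permutation of coordinates,
`(g v)(x) = v (g⁻¹ x)`. -/
def zeroSumRep (r : Setoid V) : Representation ℂ (youngSubgroup r) (zeroSum r) where
  toFun g := (LinearMap.funLeft ℂ ℂ (g.1⁻¹ : Equiv.Perm V)).restrict fun v hv x =>
    (sum_block_comp_inv g.2 v x).trans (hv x)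
  map_one' := by
    ext v x
    simp [LinearMap.funLeft]
  map_mul' a b := by
    ext v x
    simp [LinearMap.funLeft]

/-- The degree `j` part of `ℒ_{|B₁|} ⊗ ⋯ ⊗ ℒ_{|B_k|}` as a representation of the Young subgroup,
where `ℒ_a = ⋀^* 𝒮^(a-1,1) = ⨁ i, 𝒮^(a-i,1^i)`. As `⋀^* U ⊗ ⋀^* W = ⋀^* (U ⊕ W)`, this is the
`j`-th exterior power of the direct sum `zeroSum r` of the standard representations of the
blocks. -/
def blockRep (r : Setoid V) (j : ℕ) :
    Representation ℂ (youngSubgroup r) (⋀[ℂ]^j (zeroSum r)) where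
  toFun g := exteriorPower.map j (zeroSumRep r g)
  map_one' := by
    rw [map_one]
    exact exteriorPower.map_id
  map_mul' a b := by
    rw [map_mul]
    exact exteriorPower.map_comp _ _

/-- The degree `j` part `(ℳ)_j` of the graded `𝔖_V`-module of a partition of `V`: the induced
module `Ind (ℒ_{|B₁|} ⊗ ⋯ ⊗ ℒ_{|B_k|})_j` from the Young subgroup to `𝔖_V`. -/
def blockModule (r : Setoid V) (j : ℕ) : Rep ℂ (Equiv.Perm V) :=
  Rep.ind (youngSubgroup r).subtype (Rep.of (blockRep r j))

open Classical in
/-- For a subgroup of finite index the induced module is canonically isomorphic to the module of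
equivariant functions; on the latter the Frobenius reciprocity
`Hom (M, Ind N) = Hom (Res M, N)` is evaluation at the identity. -/
def blockModuleIso (r : Setoid V) (j : ℕ) :
    blockModule r j ≅ Rep.coind (youngSubgroup r).subtype (Rep.of (blockRep r j)) :=
  Rep.indCoindIso _

/-! ### Splitting the blocks of a partition -/

/-- The map that subtracts from a function its mean value over each block of `s`, from
`zeroSum r` to `zeroSum s`. If `s` refines `r`, it is the projection of the `s`-Young subgroup
module `Res (zeroSum r) = zeroSum s ⊕ (functions in zeroSum r constant on the blocks of s)` to its
first summand. -/
def blockProj (r s : Setoid V) : zeroSum r →ₗ[ℂ] zeroSum s where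
  toFun v := ⟨fun x => v.1 x - (∑ y ∈ block s x, v.1 y) / (block s x).card, fun x => by
    have h : ∀ z ∈ block s x, v.1 z - (∑ y ∈ block s z, v.1 y) / (block s z).card
        = v.1 z - (∑ y ∈ block s x, v.1 y) / (block s x).card := fun z hz => by
      rw [block_eq (mem_block.mp hz)]
    rw [Finset.sum_congr rfl h, Finset.sum_sub_distrib, Finset.sum_const, nsmul_eq_mul,
      mul_div_cancel₀ _ (card_block_ne_zero s x), sub_self]⟩
  map_add' v w := by
    ext x
    simp only [Submodule.coe_add, Pi.add_apply, Finset.sum_add_distrib]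
    ring
  map_smul' c v := by
    ext x
    simp only [Submodule.coe_smul, Pi.smul_apply, smul_eq_mul, RingHom.id_apply,
      ← Finset.mul_sum]
    ring

theorem blockProj_apply (r s : Setoid V) (v : zeroSum r) (x : V) :
    (blockProj r s v).1 x = v.1 x - (∑ y ∈ block s x, v.1 y) / (block s x).card := rfl

/-- `blockProj` is the identity on functions that lie in `zeroSum s` already. -/
theorem blockProj_of_mem {r s : Setoid V} (v : zeroSum r) (hv : v.1 ∈ zeroSum s) :
    (blockProj r s v).1 = v.1 := by
  funext x
  have h : ∑ y ∈ block s x, v.1 y = 0 := hv x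
  simp [blockProj_apply, h]

/-- `blockProj` kills the functions that are constant on the blocks of `s`. -/
theorem blockProj_of_const {r s : Setoid V} (v : zeroSum r)
    (hv : ∀ x y, s x y → v.1 x = v.1 y) : blockProj r s v = 0 := by
  ext x
  have h : ∑ y ∈ block s x, v.1 y = (block s x).card * v.1 x := by
    rw [Finset.sum_congr rfl fun y hy => (hv x y (mem_block.mp hy)).symm, Finset.sum_const,
      nsmul_eq_mul]
  rw [blockProj_apply, h, mul_div_cancel_left₀ _ (card_block_ne_zero s x), sub_self]
  rfl

theorem blockProj_self (r : Setoid V) : blockProj r r = LinearMap.id :=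
  LinearMap.ext fun v => Subtype.ext (blockProj_of_mem v v.2)

/-- Splitting blocks in two steps is the same as splitting them at once. -/
theorem blockProj_comp {r s t : Setoid V} (h : t ≤ s) :
    blockProj s t ∘ₗ blockProj r s = blockProj r t := by
  ext v x
  simp only [LinearMap.comp_apply, blockProj_apply]
  have h1 : ∀ y ∈ block t x, v.1 y - (∑ z ∈ block s y, v.1 z) / (block s y).card
      = v.1 y - (∑ z ∈ block s x, v.1 z) / (block s x).card := fun y hy => by
    rw [block_eq (h (mem_block.mp hy))]
  rw [Finset.sum_congr rfl h1, Finset.sum_sub_distrib, Finset.sum_const, nsmul_eq_mul, sub_div,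
    mul_div_cancel_left₀ _ (card_block_ne_zero t x)]
  ring

theorem blockProj_equivariant {r s : Setoid V} (h : s ≤ r) (g : youngSubgroup s) :
    blockProj r s ∘ₗ zeroSumRep r (Subgroup.inclusion (youngSubgroup_mono h) g)
      = zeroSumRep s g ∘ₗ blockProj r s := by
  ext v x
  have hx : s (g.1⁻¹ x) x := (youngSubgroup s).inv_mem g.2 x
  change v.1 (g.1⁻¹ x) - (∑ y ∈ block s x, v.1 (g.1⁻¹ y)) / (block s x).card
    = v.1 (g.1⁻¹ x) - (∑ y ∈ block s (g.1⁻¹ x), v.1 y) / (block s (g.1⁻¹ x)).card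
  rw [sum_block_comp_inv g.2, block_eq hx]

/-- The map of equivariant functions `f ↦ ⋀^j (blockProj r s) ∘ f`, for `s` finer than `r`. -/
def coindSplit {r s : Setoid V} (h : s ≤ r) (j : ℕ) :
    Rep.coind (youngSubgroup r).subtype (Rep.of (blockRep r j)) ⟶
      Rep.coind (youngSubgroup s).subtype (Rep.of (blockRep s j)) :=
  Rep.ofHom
    { toLinearMap := ((exteriorPower.map j (blockProj r s)).compLeft (Equiv.Perm V)).restrict
        fun f hf g x => by
          have h1 := hf (Subgroup.inclusion (youngSubgroup_mono h) g) x
          have h2 := congrArg (exteriorPower.map j) (blockProj_equivariant h g)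
          rw [exteriorPower.map_comp, exteriorPower.map_comp] at h2
          exact (congrArg (exteriorPower.map j (blockProj r s)) h1).trans
            (LinearMap.congr_fun h2 (f x))
      isIntertwining' := fun g => by
        ext
        rfl }

/-- The `𝔖_V`-equivariant map `ℳ_r → ℳ_s` attached to a partition `s` that refines `r`. For
blocks `B = A ⊔ A'` of `r` that are split by `s` it is, by Frobenius reciprocity, the map
`Res ℒ_B = ⋀^* 𝒯 ⊕ (⋀^* 𝒯)[1] → ⋀^* 𝒯 = ℒ_A ⊗ ℒ_A'`, `𝒯 = 𝒮^(|A|-1,1) ⊕ 𝒮^(|A'|-1,1)`, that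
is the identity on the first summand and zero on the second one, tensored with the identity of
the other blocks and induced to `𝔖_V`. If `s = r`, it is the identity. -/
def splitMap {r s : Setoid V} (h : s ≤ r) (j : ℕ) : blockModule r j ⟶ blockModule s j :=
  (blockModuleIso r j).hom ≫ coindSplit h j ≫ (blockModuleIso s j).inv

theorem splitMap_self {r : Setoid V} (h : r ≤ r) (j : ℕ) :
    splitMap h j = 𝟙 (blockModule r j) := by
  have h1 : coindSplit h j = 𝟙 _ := by
    ext f x
    refine congrArg Subtype.val (?_ : exteriorPower.map j (blockProj r r) (f.1 x) = f.1 x)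
    rw [blockProj_self, exteriorPower.map_id]
    rfl
  rw [splitMap, h1, Category.id_comp, Iso.hom_inv_id]

theorem splitMap_comp {r s t : Setoid V} (h : s ≤ r) (h' : t ≤ s) (j : ℕ) :
    splitMap h j ≫ splitMap h' j = splitMap (h'.trans h) j := by
  have h1 : coindSplit h j ≫ coindSplit h' j = coindSplit (h'.trans h) j := by
    ext f x
    refine congrArg Subtype.val
      (?_ : exteriorPower.map j (blockProj s t) (exteriorPower.map j (blockProj r s) (f.1 x))
        = exteriorPower.map j (blockProj r t) (f.1 x))
    rw [← LinearMap.comp_apply, ← exteriorPower.map_comp, blockProj_comp h']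
  simp only [splitMap, Category.assoc, Iso.inv_hom_id_assoc]
  rw [← h1, Category.assoc]

end Partition

/-! ### The chain complex of a finite multigraph -/

section Complex

variable {α β : Type*} (G : Graph α β)

/-- The partition of `V(G)` into the vertex sets of the connected components of the spanning
subgraph of `G` with edge set `F`. -/
def components (F : Finset β) : Setoid V(G) :=
  Relation.EqvGen.setoid fun x y => ∃ e ∈ F, G.IsLink e x y

theorem components_mono {F F' : Finset β} (h : F' ⊆ F) : components G F' ≤ components G F :=
  fun x y hxy => Relation.EqvGen.mono (fun _ _ ⟨e, he, hl⟩ => ⟨e, h he, hl⟩) x y hxy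

/-- The states of `G` with `i` edges: the spanning subgraphs of `G` with `i` edges, each given by
its set of edges. -/
abbrev State (i : ℕ) : Type _ := {F : Finset β // (F : Set β) ⊆ E(G) ∧ F.card = i}

instance instFiniteState [Finite E(G)] (i : ℕ) : Finite (State G i) :=
  Finite.of_injective
    (fun F : State G i => ({x : E(G) | x.1 ∈ F.1} : Set E(G))) fun F F' h => by
      refine Subtype.ext (Finset.ext fun e => ⟨fun he => ?_, fun he => ?_⟩)
      · exact (Set.ext_iff.mp h ⟨e, F.2.1 he⟩).mp he
      · exact (Set.ext_iff.mp h ⟨e, F'.2.1 he⟩).mpr he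

instance instHasFiniteBiproductsRep (H : Type*) [Group H] :
    HasFiniteBiproducts (Rep ℂ H) :=
  Abelian.hasFiniteBiproducts

variable {m : ℕ} (edges : Fin m ≃ E(G))

open Classical in
/-- The sign of the covering pair `F' = F - e` with respect to an enumeration of the edges of `G`:
`(-1)^k`, where `k` is the number of ones after the entry of `e` in the binary string of `F`, that
is, the number of edges after `e` which do not lie in `F`. -/
def sign (F F' : Finset β) : ℤ :=
  (-1) ^ (Finset.univ.filter fun l : Fin m =>
    (edges l : β) ∉ F ∧ ∃ k < l, (edges k : β) ∈ F ∧ (edges k : β) ∉ F').card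

open Classical in
theorem sign_erase {F : Finset β} {k : Fin m} (hk : (edges k : β) ∈ F) :
    sign G edges F (F.erase (edges k))
      = (-1) ^ (Finset.univ.filter fun l : Fin m => (edges l : β) ∉ F ∧ k < l).card := by
  have key : ∀ n : Fin m, ((edges n : β) ∈ F ∧ (edges n : β) ∉ F.erase (edges k)) ↔ n = k := by
    intro n
    constructor
    · rintro ⟨h1, h2⟩
      by_contra hn
      exact h2 (Finset.mem_erase.mpr ⟨fun h => hn (edges.injective (Subtype.ext h)), h1⟩)
    · rintro rfl
      exact ⟨hk, Finset.notMem_erase _ _⟩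
  simp only [sign]
  congr 2
  ext l
  simp only [Finset.mem_filter, Finset.mem_univ, true_and, key]
  exact and_congr_right fun _ => ⟨fun ⟨n, hn, he⟩ => he ▸ hn, fun h => ⟨k, h, rfl⟩⟩

open Classical in
/-- The signs along the two paths of a square of states are opposite. -/
theorem sign_square {F : Finset β} {a b : Fin m} (hab : a < b) (ha : (edges a : β) ∈ F)
    (hb : (edges b : β) ∈ F) :
    sign G edges F (F.erase (edges a))
        * sign G edges (F.erase (edges a)) ((F.erase (edges a)).erase (edges b))
      + sign G edges F (F.erase (edges b))
        * sign G edges (F.erase (edges b)) ((F.erase (edges b)).erase (edges a)) = 0 := by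
  have hne : ∀ {k l : Fin m}, k ≠ l → (edges k : β) ≠ edges l := fun h h' =>
    h (edges.injective (Subtype.ext h'))
  rw [sign_erase G edges ha, sign_erase G edges hb,
    sign_erase G edges (Finset.mem_erase.mpr ⟨hne hab.ne', hb⟩),
    sign_erase G edges (Finset.mem_erase.mpr ⟨hne hab.ne, ha⟩)]
  have h1 : (Finset.univ.filter fun l : Fin m => (edges l : β) ∉ F.erase (edges a) ∧ b < l)
      = Finset.univ.filter fun l : Fin m => (edges l : β) ∉ F ∧ b < l := by
    ext l
    simp only [Finset.mem_filter, Finset.mem_univ, true_and, Finset.mem_erase, not_and]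
    constructor
    · rintro ⟨h, hl⟩
      exact ⟨h (hne (hab.trans hl).ne'), hl⟩
    · rintro ⟨h, hl⟩
      exact ⟨fun _ => h, hl⟩
  have h2 : (Finset.univ.filter fun l : Fin m => (edges l : β) ∉ F.erase (edges b) ∧ a < l)
      = insert b (Finset.univ.filter fun l : Fin m => (edges l : β) ∉ F ∧ a < l) := by
    ext l
    simp only [Finset.mem_filter, Finset.mem_univ, true_and, Finset.mem_erase, not_and,
      Finset.mem_insert]
    constructor
    · rintro ⟨h, hl⟩
      by_cases hlb : l = b
      · exact Or.inl hlb
      · exact Or.inr ⟨h (hne hlb), hl⟩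
    · rintro (rfl | ⟨h, hl⟩)
      · exact ⟨fun h => absurd rfl h, hab⟩
      · exact ⟨fun _ => h, hl⟩
  rw [h1, h2, Finset.card_insert_of_notMem (by simp [hb])]
  ring

variable [Fintype V(G)]

/-- The chain module `C_{i,j}(G) = ⨁_{|F| = i} (ℳ_F)_j`. -/
abbrev chainModule [Finite E(G)] (i j : ℕ) : Rep ℂ (Equiv.Perm V(G)) :=
  ⨁ fun F : State G i => blockModule (components G F.1) j

open Classical in
/-- The signed per-edge map `ℳ_F → ℳ_{F'}` if `F' = F - e` for some edge `e`, and zero for all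
other pairs of a state `F` with `i + 1` edges and a state `F'` with `i` edges. -/
def signedPerEdgeMap {i : ℕ} (j : ℕ) (F : State G (i + 1)) (F' : State G i) :
    blockModule (components G F.1) j ⟶ blockModule (components G F'.1) j :=
  if h : F'.1 ⊆ F.1 then sign G edges F.1 F'.1 • splitMap (components_mono G h) j else 0

/-- The differential `d_{i+1,j} : C_{i+1,j}(G) → C_{i,j}(G)`, the sum of all signed per-edge
maps. -/
def differential [Finite E(G)] (i j : ℕ) : chainModule G (i + 1) j ⟶ chainModule G i j :=
  biproduct.lift fun F' => biproduct.desc fun F => signedPerEdgeMap G edges j F F'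

theorem lift_comp_desc {C : Type*} [Category C] [Preadditive C] {J : Type*} [Fintype J]
    {f : J → C} [HasBiproduct f] {T U : C} (g : ∀ j, T ⟶ f j) (h : ∀ j, f j ⟶ U) :
    biproduct.lift g ≫ biproduct.desc h = ∑ j, g j ≫ h j := by
  rw [← Category.comp_id (biproduct.lift g),
    ← IsBilimit.total (biproduct.isBilimit f), Preadditive.comp_sum, Preadditive.sum_comp]
  refine Finset.sum_congr rfl fun j _ => ?_
  have h1 : biproduct.lift g ≫ biproduct.π f j = g j := biproduct.lift_π _ _
  have h2 : biproduct.ι f j ≫ biproduct.desc h = h j := biproduct.ι_desc _ _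
  calc (biproduct.lift g ≫ biproduct.π f j ≫ biproduct.ι f j) ≫ biproduct.desc h
      = (biproduct.lift g ≫ biproduct.π f j) ≫ biproduct.ι f j ≫ biproduct.desc h := by
        simp only [Category.assoc]
    _ = g j ≫ h j := by rw [h1, h2]

theorem signedPerEdgeMap_comp {i j : ℕ} {F : State G (i + 2)} {F' : State G (i + 1)}
    {F'' : State G i} (h : F'.1 ⊆ F.1) (h' : F''.1 ⊆ F'.1) :
    signedPerEdgeMap G edges j F F' ≫ signedPerEdgeMap G edges j F' F''
      = (sign G edges F.1 F'.1 * sign G edges F'.1 F''.1) •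
        splitMap (components_mono G (h'.trans h)) j := by
  rw [signedPerEdgeMap, signedPerEdgeMap, dif_pos h, dif_pos h', Preadditive.zsmul_comp,
    Preadditive.comp_zsmul, splitMap_comp, smul_smul]

open Classical in
theorem sum_signedPerEdgeMap_comp (i j : ℕ) [Fintype (State G (i + 1))] (F : State G (i + 2))
    (F'' : State G i) : ∑ F' : State G (i + 1),
      signedPerEdgeMap G edges j F F' ≫ signedPerEdgeMap G edges j F' F'' = 0 := by
  by_cases hF : F''.1 ⊆ F.1
  swap
  · refine Finset.sum_eq_zero fun F' _ => ?_
    by_cases h : F'.1 ⊆ F.1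
    · have h' : ¬ F''.1 ⊆ F'.1 := fun h' => hF (h'.trans h)
      rw [signedPerEdgeMap, signedPerEdgeMap, dif_neg h', comp_zero]
    · rw [signedPerEdgeMap, dif_neg h, zero_comp]
  have hcard : (F.1 \ F''.1).card = 2 := by
    rw [Finset.card_sdiff_of_subset hF, F.2.2, F''.2.2]
    omega
  obtain ⟨x, y, hxy, hd⟩ := Finset.card_eq_two.mp hcard
  have hmem : ∀ z, (z ∈ F.1 ∧ z ∉ F''.1) ↔ (z = x ∨ z = y) := fun z => by
    rw [← Finset.mem_sdiff, hd, Finset.mem_insert, Finset.mem_singleton]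
  obtain ⟨a, b, hab, hF2⟩ : ∃ a b : Fin m, a < b ∧
      ∀ z, (z ∈ F.1 ∧ z ∉ F''.1) ↔ (z = edges a ∨ z = edges b) := by
    have hx : x ∈ E(G) := F.2.1 ((hmem x).mpr (Or.inl rfl)).1
    have hy : y ∈ E(G) := F.2.1 ((hmem y).mpr (Or.inr rfl)).1
    have hx' : (edges (edges.symm ⟨x, hx⟩) : β) = x := by simp
    have hy' : (edges (edges.symm ⟨y, hy⟩) : β) = y := by simp
    rcases lt_trichotomy (edges.symm ⟨x, hx⟩) (edges.symm ⟨y, hy⟩) with h | h | h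
    · exact ⟨_, _, h, fun z => by rw [hx', hy', hmem]⟩
    · rw [h, hy'] at hx'
      exact absurd hx'.symm hxy
    · exact ⟨_, _, h, fun z => by rw [hx', hy', hmem, or_comm]⟩
  clear hmem hd hxy x y
  have hne : (edges a : β) ≠ edges b := fun h => hab.ne (edges.injective (Subtype.ext h))
  have ha := (hF2 (edges a)).mpr (Or.inl rfl)
  have hb := (hF2 (edges b)).mpr (Or.inr rfl)
  have hErase : ∀ z ∈ F.1, ((F.1.erase z : Finset β) : Set β) ⊆ E(G) ∧
      (F.1.erase z).card = i + 1 := fun z hz =>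
    ⟨fun w hw => F.2.1 (Finset.mem_of_mem_erase hw), by
      rw [Finset.card_erase_of_mem hz, F.2.2]
      rfl⟩
  let Fa : State G (i + 1) := ⟨F.1.erase (edges a), hErase _ ha.1⟩
  let Fb : State G (i + 1) := ⟨F.1.erase (edges b), hErase _ hb.1⟩
  have hFa : Fa.1 ⊆ F.1 := Finset.erase_subset _ _
  have hFb : Fb.1 ⊆ F.1 := Finset.erase_subset _ _
  have hFa' : F''.1 ⊆ Fa.1 := fun z hz =>
    Finset.mem_erase.mpr ⟨fun h => ha.2 (h ▸ hz), hF hz⟩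
  have hFb' : F''.1 ⊆ Fb.1 := fun z hz =>
    Finset.mem_erase.mpr ⟨fun h => hb.2 (h ▸ hz), hF hz⟩
  have hab' : F''.1 = (F.1.erase (edges a)).erase (edges b) := by
    refine Finset.eq_of_subset_of_card_le
      (fun z hz => Finset.mem_erase.mpr ⟨fun h => hb.2 (h ▸ hz), hFa' hz⟩) ?_
    rw [Finset.card_erase_of_mem (Finset.mem_erase.mpr ⟨hne.symm, hb.1⟩), (hErase _ ha.1).2,
      F''.2.2]
    omega
  have hba' : F''.1 = (F.1.erase (edges b)).erase (edges a) := by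
    rw [hab', Finset.erase_right_comm]
  have hFab : Fa ≠ Fb := fun h => by
    have h1 : (edges a : β) ∈ Fb.1 := Finset.mem_erase.mpr ⟨hne, ha.1⟩
    rw [← h] at h1
    exact Finset.notMem_erase _ _ h1
  rw [Fintype.sum_eq_add Fa Fb hFab, signedPerEdgeMap_comp G edges hFa hFa',
    signedPerEdgeMap_comp G edges hFb hFb', ← add_smul]
  · have h := sign_square G edges hab ha.1 hb.1
    rw [← hab', ← hba'] at h
    exact (congrArg (fun n : ℤ => n • splitMap (components_mono G hF) j) h).trans
      (zero_smul ℤ _)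
  · rintro F' ⟨h1, h2⟩
    by_cases h : F'.1 ⊆ F.1
    swap
    · rw [signedPerEdgeMap, dif_neg h, zero_comp]
    by_cases h' : F''.1 ⊆ F'.1
    swap
    · rw [signedPerEdgeMap, signedPerEdgeMap, dif_neg h', comp_zero]
    exfalso
    have hc : (F.1 \ F'.1).card = 1 := by
      rw [Finset.card_sdiff_of_subset h, F.2.2, F'.2.2]
      omega
    obtain ⟨z, hz⟩ := Finset.card_eq_one.mp hc
    have hF' : F'.1 = F.1.erase z := by
      rw [Finset.erase_eq, ← hz, Finset.sdiff_sdiff_eq_self h]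
    have hz1 : z ∈ F.1 ∧ z ∉ F'.1 := Finset.mem_sdiff.mp (hz ▸ Finset.mem_singleton_self z)
    rcases (hF2 z).mp ⟨hz1.1, fun hh => hz1.2 (h' hh)⟩ with rfl | rfl
    · exact h1 (Subtype.ext hF')
    · exact h2 (Subtype.ext hF')

/-- The maps `differential` define a chain complex: `d ∘ d = 0`. -/
theorem differential_comp [Finite E(G)] (i j : ℕ) :
    differential G edges (i + 1) j ≫ differential G edges i j = 0 := by
  have := Fintype.ofFinite (State G (i + 1))
  refine biproduct.hom_ext _ _ fun F'' => biproduct.hom_ext' _ _ fun F => ?_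
  have h1 : differential G edges i j ≫ biproduct.π _ F''
      = biproduct.desc fun F' => signedPerEdgeMap G edges j F' F'' := biproduct.lift_π _ _
  have h2 : differential G edges (i + 1) j
      ≫ (biproduct.desc fun F' => signedPerEdgeMap G edges j F' F'')
      = ∑ F', (biproduct.desc fun F => signedPerEdgeMap G edges j F F')
        ≫ signedPerEdgeMap G edges j F' F'' :=
    lift_comp_desc _ _
  rw [zero_comp, comp_zero, Category.assoc, h1, h2, Preadditive.comp_sum,
    ← sum_signedPerEdgeMap_comp G edges i j F F'']
  exact Finset.sum_congr rfl fun F' _ => biproduct.ι_desc_assoc _ _ _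

/-- The chain complex `C_{*,j}(G)` of `𝔖_{V(G)}`-modules, for a fixed inner degree `j`. -/
def chainComplex [Finite E(G)] (j : ℕ) : ChainComplex (Rep ℂ (Equiv.Perm V(G))) ℕ :=
  ChainComplex.of (fun i => chainModule G i j) (fun i => differential G edges i j)
    fun i => differential_comp G edges i j

/-- The homology `H_{i,j}(G) = ker d_{i,j} / im d_{i+1,j}`, a representation of `𝔖_{V(G)}`. -/
def homology [Finite E(G)] (i j : ℕ) : Rep ℂ (Equiv.Perm V(G)) :=
  (chainComplex G edges j).homology i

end Complex

section Deletion

/-- Deleting edges does not change the vertex set. -/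
instance instFintypeVertexSetDeleteEdges {α β : Type*} (G : Graph α β) (F : Set β) [Fintype V(G)] :
    Fintype V(G.deleteEdges F) :=
  inferInstanceAs (Fintype V(G))

instance instFiniteEdgeSetDeleteEdges {α β : Type*} (G : Graph α β) (F : Set β) [Finite E(G)] :
    Finite E(G.deleteEdges F) :=
  Finite.Set.subset E(G) Set.sdiff_subset

end Deletion

end ChromaticSymmetric

end

/-! The states of `G` that avoid `e'` span a subcomplex, which up to signs is the complex of `G -
e'`. The quotient by it is spanned by the states that contain `e'`. For these, adding `e` does not
change the components, because `e` is parallel to `e'`. The differential therefore pairs `F` with `F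
+ e` by plus or minus the identity, the quotient is contractible, and the inclusion of the
subcomplex is an isomorphism on homology.

The contraction is explicit. Let `h` send a state with `e'` and without `e` to `F + e`, with the
sign of the pair `(F + e, F)`, and vanish on all other states. Then `1 - dh - hd` is a retraction
onto the subcomplex: it fixes the states without `e'`, kills those with both edges, and in the
remaining ones replaces `e'` by `e`, up to sign. This identity is checked in
`nonempty_cube_homology_iso`, and `nonempty_homology_iso_of_retract` draws the conclusion. All that
matters about the modules is that the transition maps are functorial in the partition
(`splitMap_self`, `splitMap_comp`). The argument thus runs for a cube over any preorder in a
preadditive category, and equivariance comes for free.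

The two enumerations of edges put different signs on the subcomplex. The sign of removing an edge is
the sign of moving it from the right end into its place in the ordered list of absent edges. Hence
the sign of the reordering of the absent edges of `F` from one enumeration to the other intertwines
the two differentials (`inversionSign_mul_sign`). -/

noncomputable section

namespace ChromaticSymmetric

/-! ### Homological algebra: strict retracts up to homotopy. -/

section Retract

variable {C : Type*} [Category C] [Preadditive C]

/-- A chain complex and a subcomplex onto which it retracts up to the homotopy `h` have the same
homology. -/
theorem nonempty_homology_iso_of_retract [CategoryWithHomology C] {K L : ChainComplex C ℕ}
    (ι : ∀ i, L.X i ⟶ K.X i) (π : ∀ i, K.X i ⟶ L.X i) (h : ∀ i, K.X i ⟶ K.X (i + 1))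
    (hι : ∀ i, ι (i + 1) ≫ K.d (i + 1) i = L.d (i + 1) i ≫ ι i) (hιπ : ∀ i, ι i ≫ π i = 𝟙 _)
    (h_zero : π 0 ≫ ι 0 + h 0 ≫ K.d (0 + 1) 0 = 𝟙 _)
    (h_succ : ∀ i, π (i + 1) ≫ ι (i + 1) + K.d (i + 1) i ≫ h i
      + h (i + 1) ≫ K.d (i + 1 + 1) (i + 1) = 𝟙 _) (n : ℕ) :
    Nonempty (K.homology n ≅ L.homology n) := by
  have hmono : ∀ i, Mono (ι i) := fun i => mono_of_mono_fac (hιπ i)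
  have hsucc : ∀ i, π (i + 1) ≫ ι (i + 1)
      = 𝟙 _ - K.d (i + 1) i ≫ h i - h (i + 1) ≫ K.d (i + 1 + 1) (i + 1) := fun i => by
    rw [← h_succ i]
    abel
  -- That `π` is a chain map follows from the homotopy identity: after composition with the
  -- monomorphism `ι`, both sides become `d - dhd`.
  have hcomm : ∀ i, π (i + 1) ≫ L.d (i + 1) i = K.d (i + 1) i ≫ π i := by
    intro i
    have h1 : K.d (i + 1) i ≫ π i ≫ ι i
        = K.d (i + 1) i - K.d (i + 1) i ≫ h i ≫ K.d (i + 1) i := by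
      cases i with
      | zero =>
        have h2 : π 0 ≫ ι 0 = 𝟙 _ - h 0 ≫ K.d (0 + 1) 0 := by
          rw [← h_zero]
          abel
        rw [h2, Preadditive.comp_sub, Category.comp_id]
      | succ i =>
        rw [hsucc, Preadditive.comp_sub, Preadditive.comp_sub, Category.comp_id,
          K.d_comp_d_assoc, zero_comp, sub_zero]
    rw [← cancel_mono (ι i), Category.assoc, Category.assoc, h1, ← hι, ← Category.assoc, hsucc,
      Preadditive.sub_comp, Preadditive.sub_comp, Category.id_comp, Category.assoc,
      Category.assoc, K.d_comp_d, comp_zero, sub_zero]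
  let I : L ⟶ K := ChainComplex.ofHom ι hι
  let Q : K ⟶ L := ChainComplex.ofHom π hcomm
  let H : ∀ i j, (ComplexShape.down ℕ).Rel j i → (K.X i ⟶ K.X j) :=
    fun i j r => h i ≫ eqToHom (congrArg K.X r)
  have hH : Q ≫ I + Homotopy.nullHomotopicMap' H = 𝟙 _ := by
    ext i
    cases i with
    | zero =>
      rw [HomologicalComplex.add_f_apply, Homotopy.nullHomotopicMap'_f_of_not_rel_left
        (k₁ := 1) (k₀ := 0) (show (ComplexShape.down ℕ).Rel 1 0 from rfl) (by simp)]
      simpa [H, Q, I] using h_zero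
    | succ i =>
      rw [HomologicalComplex.add_f_apply, Homotopy.nullHomotopicMap'_f
        (k₂ := i + 1 + 1) (k₁ := i + 1) (k₀ := i) (show (ComplexShape.down ℕ).Rel _ _ from rfl)
        (show (ComplexShape.down ℕ).Rel _ _ from rfl)]
      simpa [H, Q, I, add_assoc] using h_succ i
  exact ⟨HomotopyEquiv.toHomologyIso
    { hom := Q
      inv := I
      homotopyHomInvId := by
        refine (Homotopy.equivSubZero.symm ?_).symm
        rw [← hH, add_sub_cancel_left]
        exact Homotopy.nullHomotopy' H
      homotopyInvHomId := Homotopy.ofEq (by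
        ext i
        exact hιπ i) } n⟩

end Retract

/-! ### Complexes indexed by the finite subsets of a set -/

section Cube

variable {C : Type*} [Category C] [Preadditive C] [HasFiniteBiproducts C] {P : Type*} [Preorder P]
  {M : P → C} {β : Type*}

/-- The finite subsets with `i` elements of a set `E`. -/
abbrev Cell (E : Set β) (i : ℕ) : Type _ := {F : Finset β // (F : Set β) ⊆ E ∧ F.card = i}

open Classical in
/-- The inclusion of the summand of `⨁ F, M (c F)` at a set `F` of `i` elements, preceded by the
transition map `M r ⟶ M (c F)`; it is zero if there is no such summand or no transition map. -/
def cellIncl (μ : ∀ {r s : P}, s ≤ r → (M r ⟶ M s)) (E : Set β) [∀ i, Finite (Cell E i)]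
    (c : Finset β → P) (i : ℕ) (r : P) (F : Finset β) :
    M r ⟶ ⨁ fun F : Cell E i => M (c F.1) :=
  if h : ((F : Set β) ⊆ E ∧ F.card = i) ∧ c F ≤ r then
    μ h.2 ≫ biproduct.ι (fun F : Cell E i => M (c F.1)) ⟨F, h.1⟩ else 0

open Classical in
/-- The map with component `sgn F F'` times the transition map for `F' ⊆ F`. -/
def cubeDifferential (μ : ∀ {r s : P}, s ≤ r → (M r ⟶ M s)) (E : Set β)
    [∀ i, Finite (Cell E i)] {c : Finset β → P} (hc : ∀ {F F'}, F' ⊆ F → c F' ≤ c F)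
    (sgn : Finset β → Finset β → ℤ) (i : ℕ) :
    (⨁ fun F : Cell E (i + 1) => M (c F.1)) ⟶ ⨁ fun F : Cell E i => M (c F.1) :=
  biproduct.lift fun F' => biproduct.desc fun F =>
    if h : F'.1 ⊆ F.1 then sgn F.1 F'.1 • μ (hc h) else 0

/-- The map that sends the summand at `F` to the summand at `g F`, with coefficient `n F`. -/
def cellMap (μ : ∀ {r s : P}, s ≤ r → (M r ⟶ M s)) (E E' : Set β)
    [∀ i, Finite (Cell E i)] [∀ i, Finite (Cell E' i)] (c c' : Finset β → P) (i k : ℕ)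
    (n : Finset β → ℤ) (g : Finset β → Finset β) :
    (⨁ fun F : Cell E i => M (c F.1)) ⟶ ⨁ fun F : Cell E' k => M (c' F.1) :=
  biproduct.desc fun F => n F.1 • cellIncl μ E' c' k (c F.1) (g F.1)

variable (μ : ∀ {r s : P}, s ≤ r → (M r ⟶ M s))
  (hid : ∀ r : P, μ (le_refl r) = 𝟙 (M r))
  (hcomp : ∀ {r s t : P} (h : s ≤ r) (h' : t ≤ s), μ h ≫ μ h' = μ (h'.trans h))
  {E E' : Set β} [∀ i, Finite (Cell E i)] [∀ i, Finite (Cell E' i)] {c c' : Finset β → P}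

include hid in
theorem cellIncl_self {i : ℕ} (F : Cell E i) : cellIncl μ E c i (c F.1) F.1 =
    biproduct.ι (fun F : Cell E i => M (c F.1)) F := by
  rw [cellIncl, dif_pos ⟨F.2, le_rfl⟩, hid, Category.id_comp]

-- Tests morphisms on summands in a form to which the composition formulas for `cellIncl` apply.
include hid in
theorem hom_ext_cellIncl {i : ℕ} {Z : C} {f g : (⨁ fun F : Cell E i => M (c F.1)) ⟶ Z}
    (h : ∀ F : Cell E i,
      cellIncl μ E c i (c F.1) F.1 ≫ f = cellIncl μ E c i (c F.1) F.1 ≫ g) : f = g := by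
  refine biproduct.hom_ext' _ _ fun F => ?_
  rw [← cellIncl_self μ hid]
  exact h F

include hcomp in
theorem comp_cellIncl {i : ℕ} {r s : P} (h : s ≤ r) {F : Finset β} (hF : c F ≤ s) :
    μ h ≫ cellIncl μ E c i s F = cellIncl μ E c i r F := by
  by_cases hE : (F : Set β) ⊆ E ∧ F.card = i
  · rw [cellIncl, cellIncl, dif_pos ⟨hE, hF⟩, dif_pos ⟨hE, hF.trans h⟩, ← Category.assoc, hcomp]
  · rw [cellIncl, cellIncl, dif_neg fun h => hE h.1, dif_neg fun h => hE h.1, comp_zero]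

theorem cellIncl_of_card_ne {i : ℕ} {r : P} {F : Finset β} (h : F.card ≠ i) :
    cellIncl μ E c i r F = 0 :=
  dif_neg fun hF => h hF.1.2

open Classical in
theorem cellIncl_π {i : ℕ} {r : P} {F : Finset β} (F' : Cell E i) :
    cellIncl μ E c i r F ≫ biproduct.π (fun F : Cell E i => M (c F.1)) F' =
      if h : F = F'.1 ∧ c F'.1 ≤ r then μ h.2 else 0 := by
  by_cases hF : F = F'.1
  · subst hF
    by_cases hr : c F'.1 ≤ r
    · rw [cellIncl, dif_pos ⟨F'.2, hr⟩, dif_pos ⟨rfl, hr⟩, Category.assoc, biproduct.ι_π_self,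
        Category.comp_id]
    · rw [cellIncl, dif_neg fun h => hr h.2, dif_neg fun h => hr h.2, zero_comp]
  · rw [dif_neg fun h => hF h.1, cellIncl]
    split_ifs with h
    · rw [Category.assoc, biproduct.ι_π_ne, comp_zero]
      exact fun h' => hF (congrArg Subtype.val h')
    · exact zero_comp

-- The condition `hg` excludes a mismatch of the zero conventions: for `r` above `c F`, a transition
-- map from `M r` to the target may exist while the one from `M (c F)`, which `cellMap` uses, does
-- not.
include hcomp in
theorem cellIncl_comp_cellMap {i k : ℕ} {r : P} {F : Finset β} {n : Finset β → ℤ}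
    {g : Finset β → Finset β} (hF : (F : Set β) ⊆ E) (hi : F.card = i) (hr : c F ≤ r)
    (hg : n F = 0 ∨ c' (g F) ≤ c F) :
    cellIncl μ E c i r F ≫ cellMap μ E E' c c' i k n g = n F • cellIncl μ E' c' k r (g F) := by
  rw [cellIncl, dif_pos ⟨⟨hF, hi⟩, hr⟩, cellMap, Category.assoc, biproduct.ι_desc,
    Preadditive.comp_zsmul]
  rcases hg with hg | hg
  · rw [hg, zero_smul, zero_smul]
  · rw [comp_cellIncl μ hcomp hr hg]

-- A subset with one element less is `F.erase p` for a unique `p`. No cardinality is assumed: for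
-- `F` of the wrong size both sides vanish.
open Classical in
include hcomp in
theorem cellIncl_comp_cubeDifferential (hc : ∀ {F F'}, F' ⊆ F → c F' ≤ c F)
    (sgn : Finset β → Finset β → ℤ) {i : ℕ} {r : P} {F : Finset β} (hF : (F : Set β) ⊆ E)
    (hr : c F ≤ r) :
    cellIncl μ E c (i + 1) r F ≫ cubeDifferential μ E hc sgn i =
      ∑ p ∈ F, sgn F (F.erase p) • cellIncl μ E c i r (F.erase p) := by
  by_cases hi : F.card = i + 1
  swap
  · rw [cellIncl_of_card_ne μ hi, zero_comp]
    refine (Finset.sum_eq_zero fun p hp => ?_).symm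
    rw [cellIncl_of_card_ne, smul_zero]
    have := Finset.card_erase_add_one hp
    omega
  refine biproduct.hom_ext _ _ fun F' => ?_
  have h1 : cubeDifferential μ E hc sgn i ≫ biproduct.π _ F' = biproduct.desc fun F : Cell E (i + 1) =>
      if h : F'.1 ⊆ F.1 then sgn F.1 F'.1 • μ (hc h) else 0 := biproduct.lift_π _ _
  rw [Category.assoc, h1, cellIncl, dif_pos ⟨⟨hF, hi⟩, hr⟩, Category.assoc, biproduct.ι_desc,
    Preadditive.sum_comp]
  simp only [Preadditive.zsmul_comp, cellIncl_π]
  by_cases h : F'.1 ⊆ F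
  · rw [dif_pos h]
    obtain ⟨p, hp, hF'⟩ : ∃ p ∈ F, F.erase p = F'.1 := by
      have hcard : (F \ F'.1).card = 1 := by
        rw [Finset.card_sdiff_of_subset h, hi, F'.2.2]
        omega
      obtain ⟨p, hp⟩ := Finset.card_eq_one.mp hcard
      exact ⟨p, (Finset.mem_sdiff.mp (hp ▸ Finset.mem_singleton_self p)).1, by
        rw [Finset.erase_eq, ← hp, Finset.sdiff_sdiff_eq_self h]⟩
    rw [Finset.sum_eq_single_of_mem p hp, dif_pos ⟨hF', (hc h).trans hr⟩, Preadditive.comp_zsmul,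
      hcomp]
    · simp only [hF']
    intro q hq hqp
    rw [dif_neg, smul_zero]
    rintro ⟨hq', -⟩
    exact hqp (Finset.erase_injOn F hq hp (hq'.trans hF'.symm))
  · rw [dif_neg h, comp_zero]
    refine (Finset.sum_eq_zero fun p hp => ?_).symm
    rw [dif_neg, smul_zero]
    rintro ⟨hp', -⟩
    exact h (hp' ▸ Finset.erase_subset _ _)

end Cube

/-! ### The contraction along `e` above `e'`. -/

section Parallel

variable {C : Type*} [Category C] [Preadditive C] [HasFiniteBiproducts C] {P : Type*} [Preorder P]
  {M : P → C} {β : Type*} (μ : ∀ {r s : P}, s ≤ r → (M r ⟶ M s))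
  (hid : ∀ r : P, μ (le_refl r) = 𝟙 (M r))
  (hcomp : ∀ {r s t : P} (h : s ≤ r) (h' : t ≤ s), μ h ≫ μ h' = μ (h'.trans h))
  {E E' : Set β} {c c' : Finset β → P}
  {e e' : β} {sgn sgn' : Finset β → Finset β → ℤ} {ε : Finset β → ℤ}

open Classical in
/-- The coefficients of the homotopy that adds the edge `e` to the states that contain `e'`. -/
def homotopyCoeff (sgn : Finset β → Finset β → ℤ) (e e' : β) (F : Finset β) : ℤ :=
  if e' ∈ F ∧ e ∉ F then sgn (insert e F) F else 0

open Classical in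
/-- The states without `e'` that appear in the retraction: it replaces `e'` by `e`. -/
def retractState (e e' : β) (F : Finset β) : Finset β :=
  if e' ∈ F then (insert e F).erase e' else F

open Classical in
/-- The coefficients of the retraction onto the states that do not contain `e'`. -/
def retractCoeff (sgn : Finset β → Finset β → ℤ) (ε : Finset β → ℤ) (e e' : β)
    (F : Finset β) : ℤ :=
  if e' ∈ F then
    if e ∈ F then 0
    else -(sgn (insert e F) F * sgn (insert e F) ((insert e F).erase e')
      * ε ((insert e F).erase e'))
  else ε F

theorem notMem_retractState (e e' : β) (F : Finset β) : e' ∉ retractState e e' F := by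
  classical
  rw [retractState]
  split_ifs with h
  · exact Finset.notMem_erase _ _
  · exact h

theorem coe_retractState_subset (he : e ∈ E) {F : Finset β} (hF : (F : Set β) ⊆ E) :
    (retractState e e' F : Set β) ⊆ E \ {e'} := by
  classical
  intro p hp
  refine ⟨?_, fun h => notMem_retractState e e' F (h ▸ hp)⟩
  rw [Finset.mem_coe, retractState] at hp
  split_ifs at hp
  · rcases Finset.mem_insert.mp (Finset.mem_of_mem_erase hp) with rfl | h
    exacts [he, hF h]
  · exact hF hp

section Differential

variable [∀ i, Finite (Cell E i)] [∀ i, Finite (Cell E' i)]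
  (hc : ∀ {F F' : Finset β}, F' ⊆ F → c F' ≤ c F)
  (hc' : ∀ {F F' : Finset β}, F' ⊆ F → c' F' ≤ c' F)
  (hcc : ∀ F, e' ∉ F → c' F = c F)

-- Faces of a set without `e'` again avoid `e'`, so only the signs need to match, which is `hε`.
open Classical in
include hcc hcomp in
theorem subcubeIncl_comp (hE' : E' = E \ {e'})
    (hε : ∀ F : Finset β, (F : Set β) ⊆ E → e' ∉ F → ∀ p ∈ F,
      ε F * sgn F (F.erase p) = sgn' F (F.erase p) * ε (F.erase p))
    (hid : ∀ r : P, μ (le_refl r) = 𝟙 (M r)) (i : ℕ) :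
    cellMap μ E' E c' c (i + 1) (i + 1) ε id ≫ cubeDifferential μ E hc sgn i
      = cubeDifferential μ E' hc' sgn' i ≫ cellMap μ E' E c' c i i ε id := by
  classical
  refine hom_ext_cellIncl μ hid fun F => ?_
  have hE : ∀ p : β, p ∈ F.1 → p ∈ E ∧ p ≠ e' := fun p hp => by
    have := F.2.1 hp
    rwa [hE'] at this
  have hF : (F.1 : Set β) ⊆ E := fun p hp => (hE p hp).1
  have hFe : e' ∉ F.1 := fun h => (hE _ h).2 rfl
  rw [← Category.assoc, cellIncl_comp_cellMap μ hcomp F.2.1 F.2.2 le_rfl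
      (Or.inr (hcc _ hFe).ge), Preadditive.zsmul_comp, id,
    cellIncl_comp_cubeDifferential μ hcomp hc sgn hF (hcc _ hFe).ge, ← Category.assoc,
    cellIncl_comp_cubeDifferential μ hcomp hc' sgn' F.2.1 le_rfl, Preadditive.sum_comp,
    Finset.smul_sum]
  refine Finset.sum_congr rfl fun p hp => ?_
  have hpe : e' ∉ F.1.erase p := fun h => hFe (Finset.mem_of_mem_erase h)
  have hcard := Finset.card_erase_add_one hp
  rw [Preadditive.zsmul_comp, cellIncl_comp_cellMap μ hcomp
    (fun q hq => F.2.1 (Finset.mem_of_mem_erase hq)) (by have := F.2.2; omega)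
    (hc' (Finset.erase_subset _ _)) (Or.inr (hcc _ hpe).ge), smul_smul, smul_smul,
    hε _ hF hFe _ hp, id]

include hcc hcomp in
theorem subcubeIncl_comp_retract (hE' : E' = E \ {e'}) (hε2 : ∀ F, ε F * ε F = 1)
    (hid : ∀ r : P, μ (le_refl r) = 𝟙 (M r)) (i : ℕ) :
    cellMap μ E' E c' c i i ε id
      ≫ cellMap μ E E' c c' i i (retractCoeff sgn ε e e') (retractState e e') = 𝟙 _ := by
  refine hom_ext_cellIncl μ hid fun F => ?_
  have hE : ∀ p : β, p ∈ F.1 → p ∈ E ∧ p ≠ e' := fun p hp => by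
    have := F.2.1 hp
    rwa [hE'] at this
  have hF : (F.1 : Set β) ⊆ E := fun p hp => (hE p hp).1
  have hFe : e' ∉ F.1 := fun h => (hE _ h).2 rfl
  have hs : retractState e e' F.1 = F.1 := if_neg hFe
  have hk : retractCoeff sgn ε e e' F.1 = ε F.1 := if_neg hFe
  rw [← Category.assoc, cellIncl_comp_cellMap μ hcomp F.2.1 F.2.2 le_rfl
    (Or.inr (hcc _ hFe).ge), Preadditive.zsmul_comp, id,
    cellIncl_comp_cellMap μ hcomp hF F.2.2 (hcc _ hFe).ge
      (Or.inr (by rw [hs, hcc _ hFe])), hs, hk, smul_smul, hε2, one_smul, Category.comp_id]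

include hcomp hcc in
theorem cellIncl_comp_retract (he : e ∈ E) (hE' : E' = E \ {e'})
    (hpar : ∀ F : Finset β, e' ∈ F → ∀ F', (∀ p ∈ F', p = e ∨ p ∈ F) → c F' ≤ c F)
    {i : ℕ} {F : Finset β} (hF : (F : Set β) ⊆ E) (hi : F.card = i) :
    cellIncl μ E c i (c F) F ≫ cellMap μ E E' c c' i i (retractCoeff sgn ε e e')
      (retractState e e') ≫ cellMap μ E' E c' c i i ε id
      = (retractCoeff sgn ε e e' F * ε (retractState e e' F))
        • cellIncl μ E c i (c F) (retractState e e' F) := by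
  classical
  have hs := hcc _ (notMem_retractState e e' F)
  have hle : c (retractState e e' F) ≤ c F := by
    rw [retractState]
    split_ifs with h
    · refine hpar _ h _ fun p hp => ?_
      exact Finset.mem_insert.mp (Finset.mem_of_mem_erase hp)
    · exact le_rfl
  rw [← Category.assoc, cellIncl_comp_cellMap μ hcomp hF hi le_rfl (Or.inr (hs.trans_le hle)),
    Preadditive.zsmul_comp]
  -- The size changes only if `F` contains both `e` and `e'`; then both sides vanish by the zero
  -- convention of `cellIncl`.
  by_cases hcard : (retractState e e' F).card = i
  · rw [cellIncl_comp_cellMap μ hcomp (hE' ▸ coe_retractState_subset he hF) hcard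
      (hs.trans_le hle) (Or.inr hs.ge), smul_smul, id]
  · rw [cellIncl_of_card_ne μ hcard, cellIncl_of_card_ne μ hcard, zero_comp, smul_zero, smul_zero]

-- If `e' ∈ F`, `hpar` supplies the transition map to `insert e F`; otherwise the coefficient is
-- zero and none is needed.
include hcomp in
theorem cellIncl_comp_homotopy
    (hpar : ∀ F : Finset β, e' ∈ F → ∀ F', (∀ p ∈ F', p = e ∨ p ∈ F) → c F' ≤ c F)
    [DecidableEq β] {i : ℕ} {r : P} {F : Finset β} (hF : (F : Set β) ⊆ E) (hi : F.card = i)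
    (hr : c F ≤ r) :
    cellIncl μ E c i r F ≫ cellMap μ E E c c i (i + 1) (homotopyCoeff sgn e e') (insert e)
      = homotopyCoeff sgn e e' F • cellIncl μ E c (i + 1) r (insert e F) := by
  refine cellIncl_comp_cellMap μ hcomp hF hi hr ?_
  by_cases h : e' ∈ F
  · exact Or.inr (hpar _ h _ fun p hp => Finset.mem_insert.mp hp)
  · exact Or.inl (if_neg fun h' => h h'.1)

open Classical in
include hcomp hcc hc hid in
/-- A cube that has the same transition maps with and without `e` above `e'` retracts onto the
subcube of the sets that do not contain `e'`. -/
theorem nonempty_cube_homology_iso [CategoryWithHomology C] (hne : e ≠ e') (he : e ∈ E)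
    (hE' : E' = E \ {e'})
    (hpar : ∀ F : Finset β, e' ∈ F → ∀ F', (∀ p ∈ F', p = e ∨ p ∈ F) → c F' ≤ c F)
    (hs : ∀ F F', sgn F F' * sgn F F' = 1)
    (hsq : ∀ F : Finset β, (F : Set β) ⊆ E → ∀ p ∈ F, ∀ q ∈ F, p ≠ q →
      sgn F (F.erase p) * sgn (F.erase p) ((F.erase p).erase q)
        + sgn F (F.erase q) * sgn (F.erase q) ((F.erase q).erase p) = 0)
    (hε2 : ∀ F, ε F * ε F = 1)
    (hε : ∀ F : Finset β, (F : Set β) ⊆ E → e' ∉ F → ∀ p ∈ F,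
      ε F * sgn F (F.erase p) = sgn' F (F.erase p) * ε (F.erase p))
    (hd : ∀ i, cubeDifferential μ E hc sgn (i + 1) ≫ cubeDifferential μ E hc sgn i = 0)
    (hd' : ∀ i, cubeDifferential μ E' hc' sgn' (i + 1) ≫ cubeDifferential μ E' hc' sgn' i = 0)
    (n : ℕ) :
    Nonempty ((ChainComplex.of (fun i => ⨁ fun F : Cell E i => M (c F.1))
      (cubeDifferential μ E hc sgn) hd).homology n ≅
      (ChainComplex.of (fun i => ⨁ fun F : Cell E' i => M (c' F.1))
      (cubeDifferential μ E' hc' sgn') hd').homology n) := by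
  classical
  refine nonempty_homology_iso_of_retract
    (K := ChainComplex.of (fun i => ⨁ fun F : Cell E i => M (c F.1))
      (cubeDifferential μ E hc sgn) hd)
    (L := ChainComplex.of (fun i => ⨁ fun F : Cell E' i => M (c' F.1))
      (cubeDifferential μ E' hc' sgn') hd')
    (fun i => cellMap μ E' E c' c i i ε id)
    (fun i => cellMap μ E E' c c' i i (retractCoeff sgn ε e e') (retractState e e'))
    (fun i => cellMap μ E E c c i (i + 1) (homotopyCoeff sgn e e') (insert e))
    ?_ (subcubeIncl_comp_retract μ hcomp hcc hE' hε2 hid) ?_ ?_ n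
  · intro i
    simp only [ChainComplex.of_d]
    exact subcubeIncl_comp μ hcomp hc hc' hcc hE' hε hid i
  -- In degree zero the only state is the empty one, which avoids `e'`.
  · simp only [ChainComplex.of_d]
    refine hom_ext_cellIncl μ hid fun F => ?_
    have hF : F.1 = ∅ := Finset.card_eq_zero.mp F.2.2
    have hFe : e' ∉ F.1 := by simp [hF]
    have h1 : retractState e e' F.1 = F.1 := if_neg hFe
    have h2 : retractCoeff sgn ε e e' F.1 = ε F.1 := if_neg hFe
    have h3 : homotopyCoeff sgn e e' F.1 = 0 := if_neg fun h => hFe h.1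
    rw [Preadditive.comp_add, cellIncl_comp_retract μ hcomp hcc he hE' hpar F.2.1 F.2.2,
      ← Category.assoc, cellIncl_comp_homotopy μ hcomp hpar F.2.1 F.2.2 le_rfl, h1, h2, h3, hε2,
      one_smul, zero_smul, zero_comp, add_zero, Category.comp_id]
  · intro i
    simp only [ChainComplex.of_d]
    refine hom_ext_cellIncl μ hid fun F => ?_
    obtain ⟨F, hF, hi⟩ := F
    have hcard : ∀ p ∈ F, (F.erase p).card = i := fun p hp => by
      have := Finset.card_erase_add_one hp
      omega
    have hsum : cellIncl μ E c (i + 1) (c F) F ≫ cubeDifferential μ E hc sgn i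
        ≫ cellMap μ E E c c i (i + 1) (homotopyCoeff sgn e e') (insert e)
        = ∑ p ∈ F, (sgn F (F.erase p) * homotopyCoeff sgn e e' (F.erase p))
          • cellIncl μ E c (i + 1) (c F) (insert e (F.erase p)) := by
      rw [← Category.assoc, cellIncl_comp_cubeDifferential μ hcomp hc sgn hF le_rfl,
        Preadditive.sum_comp]
      refine Finset.sum_congr rfl fun p hp => ?_
      rw [Preadditive.zsmul_comp, cellIncl_comp_homotopy μ hcomp hpar
        (fun q hq => hF (Finset.mem_of_mem_erase hq)) (hcard p hp) (hc (Finset.erase_subset _ _)),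
        smul_smul]
    rw [Preadditive.comp_add, Preadditive.comp_add,
      cellIncl_comp_retract μ hcomp hcc he hE' hpar hF hi, hsum,
      ← Category.assoc (cellIncl μ E c (i + 1) (c F) F),
      cellIncl_comp_homotopy μ hcomp hpar hF hi le_rfl, Preadditive.zsmul_comp, Category.comp_id]
    -- Without `e'`, the retraction is the identity and the homotopy vanishes on `F` and on all its
    -- faces.
    by_cases hFe' : e' ∈ F
    swap
    · have h1 : retractState e e' F = F := if_neg hFe'
      have h2 : retractCoeff sgn ε e e' F = ε F := if_neg hFe'
      have h3 : homotopyCoeff sgn e e' F = 0 := if_neg fun h => hFe' h.1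
      rw [h1, h2, h3, hε2, one_smul, zero_smul, add_zero, add_eq_left]
      refine Finset.sum_eq_zero fun p hp => ?_
      have h4 : homotopyCoeff sgn e e' (F.erase p) = 0 :=
        if_neg fun h => hFe' (Finset.mem_of_mem_erase h.1)
      rw [h4, mul_zero, zero_smul]
    -- With both edges, only the path that removes `e` and adds it back survives; its sign is a
    -- square.
    by_cases hFe : e ∈ F
    · have h2 : retractCoeff sgn ε e e' F = 0 := by rw [retractCoeff, if_pos hFe', if_pos hFe]
      have h3 : homotopyCoeff sgn e e' F = 0 := if_neg fun h => h.2 hFe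
      rw [h2, h3, zero_mul, zero_smul, zero_smul, add_zero, zero_add,
        Finset.sum_eq_single_of_mem e hFe]
      · have h4 : homotopyCoeff sgn e e' (F.erase e) = sgn F (F.erase e) := by
          rw [homotopyCoeff, if_pos ⟨Finset.mem_erase.mpr ⟨hne.symm, hFe'⟩,
            Finset.notMem_erase _ _⟩, Finset.insert_erase hFe]
        rw [h4, hs, one_smul, Finset.insert_erase hFe]
      · intro p hp hpe
        have h4 : homotopyCoeff sgn e e' (F.erase p) = 0 :=
          if_neg fun h => h.2 (Finset.mem_erase.mpr ⟨hpe.symm, hFe⟩)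
        rw [h4, mul_zero, zero_smul]
    · have h1 : retractState e e' F = (insert e F).erase e' := if_pos hFe'
      have h2 : retractCoeff sgn ε e e' F = -(sgn (insert e F) F
          * sgn (insert e F) ((insert e F).erase e') * ε ((insert e F).erase e')) := by
        rw [retractCoeff, if_pos hFe', if_neg hFe]
      have h3 : homotopyCoeff sgn e e' F = sgn (insert e F) F := if_pos ⟨hFe', hFe⟩
      have hFi : ((insert e F : Finset β) : Set β) ⊆ E := by
        rw [Finset.coe_insert]
        exact Set.insert_subset he hF
      have h5 : ∀ p ∈ F, insert e (F.erase p) = (insert e F).erase p := fun p hp =>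
        (Finset.erase_insert_of_ne (by rintro rfl; exact hFe hp)).symm
      rw [cellIncl_comp_cubeDifferential μ hcomp hc sgn hFi
        (hpar _ hFe' _ fun p hp => Finset.mem_insert.mp hp), Finset.sum_insert hFe,
        Finset.erase_insert hFe, smul_add, smul_smul, h3, hs, one_smul, h1, h2, neg_mul, mul_assoc,
        hε2, mul_one, Finset.smul_sum]
      -- Removing `p` and adding `e` in either order gives opposite signs, so these terms cancel.
      -- The exception is `p = e'`: the homotopy vanishes on `F.erase e'`, and the term left over is
      -- the one that the retraction cancels.
      have h6 : ∑ p ∈ F, (sgn F (F.erase p) * homotopyCoeff sgn e e' (F.erase p))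
            • cellIncl μ E c (i + 1) (c F) (insert e (F.erase p))
          + ∑ p ∈ F, sgn (insert e F) F • sgn (insert e F) ((insert e F).erase p)
            • cellIncl μ E c (i + 1) (c F) ((insert e F).erase p)
          = (sgn (insert e F) F * sgn (insert e F) ((insert e F).erase e'))
            • cellIncl μ E c (i + 1) (c F) ((insert e F).erase e') := by
        rw [← Finset.sum_add_distrib, Finset.sum_eq_single_of_mem e' hFe']
        · have h4 : homotopyCoeff sgn e e' (F.erase e') = 0 :=
            if_neg fun h => Finset.notMem_erase _ _ h.1
          rw [h4, mul_zero, zero_smul, zero_add, smul_smul]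
        · intro p hp hpe
          have h4 : homotopyCoeff sgn e e' (F.erase p)
              = sgn ((insert e F).erase p) (F.erase p) := by
            rw [homotopyCoeff, if_pos ⟨Finset.mem_erase.mpr ⟨hpe.symm, hFe'⟩,
              fun h => hFe (Finset.mem_of_mem_erase h)⟩, h5 p hp]
          have hpe' : p ≠ e := fun h => hFe (h ▸ hp)
          have hmem : p ∈ insert e F := Finset.mem_insert_of_mem hp
          have h7 := hsq (insert e F) hFi e (Finset.mem_insert_self e F) p hmem hpe'.symm
          rw [Finset.erase_right_comm (a := p), Finset.erase_insert hFe] at h7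
          rw [h4, h5 p hp, smul_smul, ← add_smul]
          have h8 := hs (insert e F) F
          have h9 := hs ((insert e F).erase p) (F.erase p)
          set a := sgn (insert e F) F
          set b := sgn F (F.erase p)
          set x := sgn (insert e F) ((insert e F).erase p)
          set y := sgn ((insert e F).erase p) (F.erase p)
          -- The square relation `h7` is `a * b + x * y = 0`; multiply it by `a * y` and use that
          -- `a` and `y` square to one.
          have h10 : b * y + a * x = 0 := by
            linear_combination (a * y) * h7 - b * y * h8 - a * x * h9
          rw [h10, zero_smul]
      rw [add_comm (cellIncl μ E c (i + 1) (c F) F), ← add_assoc,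
        add_assoc (-_ • _), h6, ← add_smul, neg_add_cancel, zero_smul, zero_add]

end Differential

end Parallel

/-! ### Signs of reordering. -/

section Sign

theorem neg_one_pow_card_filter {ι : Type*} (A : Finset ι) (p : ι → Prop) [DecidablePred p] :
    (-1 : ℤ) ^ (A.filter p).card = ∏ l ∈ A, if p l then -1 else 1 := by
  simp [Finset.prod_ite]

variable {ι : Type*} [LinearOrder ι]

/-- The sign of the pairs in `A` whose order is reversed by `r`. -/
def inversionSign (r : ι → ℕ) (A : Finset ι) : ℤ :=
  ∏ a ∈ A, ∏ b ∈ A, if a < b ∧ r b < r a then -1 else 1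

theorem inversionSign_mul_self (r : ι → ℕ) (A : Finset ι) :
    inversionSign r A * inversionSign r A = 1 := by
  simp only [inversionSign, ← Finset.prod_mul_distrib]
  exact Finset.prod_eq_one fun a _ => Finset.prod_eq_one fun b _ => by split_ifs <;> rfl

/-- For each `l` in `A`, the two orders disagree on whether `l` comes after `k` exactly when the
pair `k`, `l` is an inversion. The factors match one `l` at a time. -/
theorem inversionSign_insert {r : ι → ℕ} (hr : Function.Injective r) {A : Finset ι} {k : ι}
    (hk : k ∉ A) :
    inversionSign r A * (-1) ^ (A.filter fun l => k < l).card
      = (-1) ^ (A.filter fun l => r k < r l).card * inversionSign r (insert k A) := by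
  have h1 : inversionSign r (insert k A) = (∏ l ∈ A, if k < l ∧ r l < r k then (-1 : ℤ) else 1)
      * (∏ l ∈ A, if l < k ∧ r k < r l then (-1 : ℤ) else 1) * inversionSign r A := by
    simp only [inversionSign, Finset.prod_insert hk, Finset.prod_mul_distrib, lt_irrefl, false_and,
      if_false, one_mul, mul_assoc]
  rw [h1, neg_one_pow_card_filter, neg_one_pow_card_filter, mul_comm, ← mul_assoc,
    ← Finset.prod_mul_distrib, ← Finset.prod_mul_distrib]
  congr 1
  refine Finset.prod_congr rfl fun l hl => ?_
  have hlk : l ≠ k := fun h => hk (h ▸ hl)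
  rcases lt_or_gt_of_ne hlk with h | h <;> rcases lt_or_gt_of_ne (hr.ne hlk) with h' | h' <;>
    simp [h, h', h.not_gt, h'.not_gt]

end Sign

/-! ### Components and signs after deletion of a parallel edge. -/

section Deletion

variable {α β : Type*} (G : Graph α β)

theorem sign_mul_self {m : ℕ} (edges : Fin m ≃ E(G)) (F F' : Finset β) :
    sign G edges F F' * sign G edges F F' = 1 := by
  rw [sign, ← mul_pow, neg_one_mul, neg_neg, one_pow]

theorem components_deleteEdges {e' : β} {F : Finset β} (hF : e' ∉ F) :
    components (G.deleteEdges {e'}) F = components G F := by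
  have h : (fun x y : V(G) => ∃ e ∈ F, (G.deleteEdges {e'}).IsLink e x y)
      = fun x y : V(G) => ∃ e ∈ F, G.IsLink e x y := by
    funext x y
    refine propext (exists_congr fun e => and_congr_right fun he => ?_)
    rw [Graph.deleteEdges_isLink]
    exact and_iff_left fun h => hF (h ▸ he)
  exact congrArg Relation.EqvGen.setoid h

/-- Every use of `e` in a path can be replaced by `e'`, which has the same ends and lies in `F`. -/
theorem components_le_of_parallel {e e' : β} {x y : α} (he : G.IsLink e x y)
    (he' : G.IsLink e' x y) {F F' : Finset β} (hF : e' ∈ F) (hF' : ∀ p ∈ F', p = e ∨ p ∈ F) :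
    components G F' ≤ components G F := by
  refine fun a b hab => Relation.EqvGen.mono (fun a b ⟨p, hp, hl⟩ => ?_) a b hab
  rcases hF' p hp with rfl | h
  · refine ⟨e', hF, ?_⟩
    rcases hl.eq_and_eq_or_eq_and_eq he with ⟨h1, h2⟩ | ⟨h1, h2⟩
    · rwa [h1, h2]
    · rw [h1, h2]
      exact he'.symm
  · exact ⟨p, h, hl⟩

variable {m m' : ℕ} (edges : Fin m ≃ E(G)) {e' : β} (edges' : Fin m' ≃ E(G.deleteEdges {e'}))

open Classical in
/-- The position of the edges of `G` in an enumeration of the edges of `G - e'`, with `e'` put in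
front of the other edges. -/
def deletionRank (k : Fin m) : ℕ :=
  if h : (edges k : β) ∈ E(G.deleteEdges {e'}) then (edges'.symm ⟨edges k, h⟩ : ℕ) + 1 else 0

theorem mem_deleteEdges_iff {p : β} : p ∈ E(G.deleteEdges {e'}) ↔ p ∈ E(G) ∧ p ≠ e' := by
  simp

theorem deletionRank_injective : Function.Injective (deletionRank G edges edges') := by
  intro k l hkl
  unfold deletionRank at hkl
  split_ifs at hkl with hk hl hl
  · have h1 := edges'.symm.injective (Fin.ext (Nat.succ_injective hkl))
    exact edges.injective (Subtype.ext (Subtype.mk.inj h1))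
  · have h : ∀ k, (edges k : β) ∉ E(G.deleteEdges {e'}) → (edges k : β) = e' := fun k hk => by
      by_contra h
      exact hk ((mem_deleteEdges_iff G).mpr ⟨(edges k).2, h⟩)
    exact edges.injective (Subtype.ext ((h k hk).trans (h l hl).symm))

open Classical in
/-- The edges that are not in `F`, as indices. -/
def absentEdges (F : Finset β) : Finset (Fin m) :=
  Finset.univ.filter fun l => (edges l : β) ∉ F

open Classical in
theorem absentEdges_erase {F : Finset β} {k : Fin m} (hk : (edges k : β) ∈ F) :
    absentEdges G edges (F.erase (edges k)) = insert k (absentEdges G edges F) := by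
  ext l
  simp only [absentEdges, Finset.mem_filter, Finset.mem_univ, true_and, Finset.mem_erase,
    Finset.mem_insert, not_and]
  constructor
  · intro h
    by_cases hlk : l = k
    · exact Or.inl hlk
    · exact Or.inr (h fun h' => hlk (edges.injective (Subtype.ext h')))
  · rintro (rfl | h)
    · exact fun h => absurd rfl h
    · exact fun _ => h

-- Expresses the sign for `G - e'` through indices of edges of `G`, so that both signs count
-- elements of the same set `absentEdges G edges F`.
open Classical in
theorem sign_deleteEdges_erase {F : Finset β} (he' : e' ∉ F) {k : Fin m}
    (hk : (edges k : β) ∈ F) :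
    sign (G.deleteEdges {e'}) edges' F (F.erase (edges k))
      = (-1) ^ ((absentEdges G edges F).filter fun l =>
        deletionRank G edges edges' k < deletionRank G edges edges' l).card := by
  have hk' : (edges k : β) ∈ E(G.deleteEdges {e'}) :=
    (mem_deleteEdges_iff G).mpr ⟨(edges k).2, fun h => he' (h ▸ hk)⟩
  have h1 : ((edges' (edges'.symm ⟨edges k, hk'⟩) : E(G.deleteEdges {e'})) : β) = edges k := by
    simp
  have h2 := sign_erase (G.deleteEdges {e'}) edges' (F := F) (k := edges'.symm ⟨edges k, hk'⟩)
    (by rwa [h1])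
  rw [h1] at h2
  rw [h2]
  congr 1
  have hmem : ∀ l, (edges' l : β) ∈ E(G) := fun l => ((mem_deleteEdges_iff G).mp (edges' l).2).1
  have hl : ∀ l, (edges (edges.symm ⟨edges' l, hmem l⟩) : β) = edges' l := fun l => by simp
  have hrank : ∀ l, deletionRank G edges edges' (edges.symm ⟨edges' l, hmem l⟩) = l + 1 :=
    fun l => by
      rw [deletionRank, dif_pos (by rw [hl]; exact (edges' l).2)]
      simp only [hl, Subtype.coe_eta, Equiv.symm_apply_apply]
  have hrk : deletionRank G edges edges' k = (edges'.symm ⟨edges k, hk'⟩ : ℕ) + 1 := dif_pos hk'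
  refine Finset.card_bij (fun l _ => edges.symm ⟨edges' l, hmem l⟩) ?_ ?_ ?_
  · intro l h
    simp only [Finset.mem_filter, Finset.mem_univ, true_and, absentEdges] at h ⊢
    rw [hl, hrank, hrk]
    exact ⟨h.1, Nat.succ_lt_succ h.2⟩
  · intro l _ l' _ h
    have h3 := congrArg Subtype.val (edges.symm.injective h)
    exact edges'.injective (Subtype.ext h3)
  · intro l h
    simp only [Finset.mem_filter, Finset.mem_univ, true_and, absentEdges] at h
    -- Only `e'` has rank zero, and nothing ranks below it, so this extra absent edge is never
    -- counted.
    have hlE : (edges l : β) ∈ E(G.deleteEdges {e'}) := by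
      by_contra hlE
      have : deletionRank G edges edges' l = 0 := dif_neg hlE
      omega
    have hrl : deletionRank G edges edges' l = (edges'.symm ⟨edges l, hlE⟩ : ℕ) + 1 := dif_pos hlE
    refine ⟨edges'.symm ⟨edges l, hlE⟩, ?_, ?_⟩
    · simp only [Finset.mem_filter, Finset.mem_univ, true_and, Equiv.apply_symm_apply]
      refine ⟨h.1, ?_⟩
      rw [Fin.lt_def]
      omega
    · rw [Equiv.symm_apply_eq]
      exact Subtype.ext (by simp)

open Classical in
theorem inversionSign_mul_sign {F : Finset β} (hF : (F : Set β) ⊆ E(G)) (he' : e' ∉ F) {p : β}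
    (hp : p ∈ F) :
    inversionSign (deletionRank G edges edges') (absentEdges G edges F)
        * sign G edges F (F.erase p)
      = sign (G.deleteEdges {e'}) edges' F (F.erase p)
        * inversionSign (deletionRank G edges edges') (absentEdges G edges (F.erase p)) := by
  obtain ⟨k, rfl⟩ : ∃ k, (edges k : β) = p := ⟨edges.symm ⟨p, hF hp⟩, by simp⟩
  have hk : k ∉ absentEdges G edges F := by simpa [absentEdges] using hp
  rw [sign_deleteEdges_erase G edges edges' he' hp, absentEdges_erase G edges hp,
    ← inversionSign_insert (deletionRank_injective G edges edges') hk, sign_erase G edges hp,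
    absentEdges, Finset.filter_filter]

open Classical in
theorem sign_erase_erase {F : Finset β} (hF : (F : Set β) ⊆ E(G)) {p q : β} (hp : p ∈ F)
    (hq : q ∈ F) (hpq : p ≠ q) :
    sign G edges F (F.erase p) * sign G edges (F.erase p) ((F.erase p).erase q)
      + sign G edges F (F.erase q) * sign G edges (F.erase q) ((F.erase q).erase p) = 0 := by
  obtain ⟨k, rfl⟩ : ∃ k, (edges k : β) = p := ⟨edges.symm ⟨p, hF hp⟩, by simp⟩
  obtain ⟨l, rfl⟩ : ∃ l, (edges l : β) = q := ⟨edges.symm ⟨q, hF hq⟩, by simp⟩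
  rcases lt_or_gt_of_ne (fun h => hpq (by rw [h]) : k ≠ l) with h | h
  · exact sign_square G edges h hp hq
  · rw [add_comm]
    exact sign_square G edges h hq hp

end Deletion

end ChromaticSymmetric

end

open ChromaticSymmetric in
theorem proposition3p2 {α β : Type*} (G : Graph α β) [Fintype V(G)] [Finite E(G)]
    {e e' : β} {x y : α} (hne : e ≠ e') (he : G.IsLink e x y) (he' : G.IsLink e' x y)
    {m m' : ℕ} (edges : Fin m ≃ E(G)) (edges' : Fin m' ≃ E(G.deleteEdges {e'})) (i j : ℕ) :
    Nonempty (ChromaticSymmetric.homology G edges i j ≅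
      ChromaticSymmetric.homology (G.deleteEdges {e'}) edges' i j) := by
  have hfin : ∀ i, Finite (Cell E(G) i) := fun i => instFiniteState G i
  have hfin' : ∀ i, Finite (Cell E(G.deleteEdges {e'}) i) :=
    fun i => instFiniteState (G.deleteEdges {e'}) i
  -- Both chain complexes are cube complexes by definition, and the two vertex sets agree
  -- definitionally.
  exact nonempty_cube_homology_iso (P := Setoid V(G)) (M := fun r => blockModule r j)
    (fun h => splitMap h j) (fun r => splitMap_self le_rfl j)
    (fun h h' => splitMap_comp h h' j) (E := E(G)) (E' := E(G.deleteEdges {e'}))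
    (c := components G) (c' := components (G.deleteEdges {e'}))
    (ε := fun F => inversionSign (deletionRank G edges edges') (absentEdges G edges F))
    (components_mono G) (components_mono (G.deleteEdges {e'}))
    (fun F hF => components_deleteEdges G hF) hne he.edge_mem (by simp)
    (fun F hF F' hF' => components_le_of_parallel G he he' hF hF')
    (sign_mul_self G edges)
    (fun F hF p hp q hq hpq => sign_erase_erase G edges hF hp hq hpq)
    (fun F => inversionSign_mul_self _ _)
    (fun F hF hFe' p hp => inversionSign_mul_sign G edges edges' hF hFe' hp)
    (fun i => differential_comp G edges i j)
    (fun i => differential_comp (G.deleteEdges {e'}) edges' i j) i
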